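/- For a real-valued $\bar\omega\in C_c^\infty(\mathbb R^2)$ let $\bar v(x)=\frac1{2\pi}\int_{\mathbb R^2}\frac{(x-y)^\perp}{|x-y|^2}\,\bar\omega(y)\,dy$ be its velocity (Biot--Savart law $\bar v=\nabla^\perp\Delta^{-1}\bar\omega$), where $(z_1,z_2)^\perp=(-z_2,z_1)$, and let $$L=T+K,\qquad Tw=-\bar v\cdot\nabla w,\qquad Kw=-v\cdot\nabla\bar\omega,$$ be the linearization of the two-dimensional Euler equation in vorticity form around $\bar\omega$. Here $w\in L^2(\mathbb R^2;\mathbb C)$ is such that its Biot--Savart integral $v=\frac1{2\pi}\int\frac{(x-y)^\perp}{|x-y|^2}w(y)\,dy$ converges absolutely for almost every $x$, the expression $Tw=-\mathrm{div}(\bar v\,w)$ is understood in the sense of distributions, and $Tw$ and $Kw$ are in $L^2$. For $n\in\mathbb N$, $n\ge1$, let $$U_n=\{w\in L^2(\mathbb R^2;\mathbb C): w(re^{i\theta})=w_n(r)e^{in\theta}\text{ for some function }w_n\}.$$ A radially symmetric $\bar\omega$ is called an unstable vortex if, for some $n\ge1$, there are $0\ne w\in U_n$ and $\lambda\in\mathbb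 C$ with $\Re\lambda>0$ such that $Lw=\lambda w$. **Theorem.** There exists an unstable vortex $\bar\Omega\in C_c^\infty(\mathbb R^2)$ with zero mean, $\int_{\mathbb R^2}\bar\Omega\,dx=0$. -/

import Mathlib

open MeasureTheory
open scoped ContDiff

noncomputable section

namespace Euler2D

/-! The plane `ℝ²` is identified with `ℂ` through `x = x₁ + i x₂ = r e^{iθ}`; this carries the
Euclidean norm and the Lebesgue measure. All derivatives are real derivatives. A vector field with
values in `F²` (with `F = ℝ` or `F = ℂ`) is a function `ℂ → F × F`. -/

/-- The Biot-Savart kernel `z^⊥ / (2π|z|²)`, where `z^⊥ = (-z₂, z₁) = i z`. -/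
def kernel (z : ℂ) : ℂ := Complex.I * z / ((2 * Real.pi * ‖z‖ ^ 2 : ℝ) : ℂ)

/-- The velocity `v = ∇^⊥ Δ⁻¹ w`, written as the Biot-Savart integral
`v(x) = (1/2π) ∫ (x - y)^⊥ / |x - y|² w(y) dy`, of a real- or complex-valued vorticity `w`. -/
def velocity {F : Type*} [NormedAddCommGroup F] [NormedSpace ℝ F] (w : ℂ → F) (x : ℂ) : F × F :=
  (∫ y, (kernel (x - y)).re • w y, ∫ y, (kernel (x - y)).im • w y)

/-- The Biot-Savart integral of `w` converges absolutely at almost every point. -/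
def HasVelocity {F : Type*} [NormedAddCommGroup F] [NormedSpace ℝ F] (w : ℂ → F) : Prop :=
  ∀ᵐ x : ℂ, Integrable (fun y => (kernel (x - y)).re • w y) ∧
    Integrable (fun y => (kernel (x - y)).im • w y)

/-- The partial derivative `∂₁ f`. -/
def partialX (f : ℂ → ℝ) (x : ℂ) : ℝ := fderiv ℝ f x 1

/-- The partial derivative `∂₂ f`. -/
def partialY (f : ℂ → ℝ) (x : ℂ) : ℝ := fderiv ℝ f x Complex.I

/-- `f = T w` where `T w = - v̄ · ∇ w = - div (v̄ w)` in the sense of distributions, and `v̄` is the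
(divergence free) velocity of the background vorticity `Ω`:
`∫ (v̄ · ∇φ) w = ∫ φ f` for all test functions `φ ∈ C_c^∞(ℝ²)`. -/
def IsTransport (Ω : ℂ → ℝ) (w f : ℂ → ℂ) : Prop :=
  ∀ φ : ℂ → ℝ, ContDiff ℝ ∞ φ → HasCompactSupport φ →
    (∫ x, ((velocity Ω x).1 * partialX φ x + (velocity Ω x).2 * partialY φ x) • w x) =
      (∫ x, φ x • f x)

/-- `K w = - v · ∇Ω`, where `v` is the velocity of `w`. -/
def opK (Ω : ℂ → ℝ) (w : ℂ → ℂ) (x : ℂ) : ℂ :=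
  -(partialX Ω x • (velocity w x).1 + partialY Ω x • (velocity w x).2)

/-- `w` is in the domain of the operator `L = T + K` on `L²(ℝ²; ℂ)`, the linearization of the Euler
equation around `Ω`, and `L w = g`. -/
def IsLinearizedEuler (Ω : ℂ → ℝ) (w g : ℂ → ℂ) : Prop :=
  MemLp w 2 volume ∧ HasVelocity w ∧
    ∃ f : ℂ → ℂ, MemLp f 2 volume ∧ IsTransport Ω w f ∧ MemLp (opK Ω w) 2 volume ∧
      ∀ᵐ x : ℂ, g x = f x + opK Ω w x

/-- The space `U_n = {w ∈ L² : w(r e^{iθ}) = w_n(r) e^{inθ}}`. -/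
def MemU (n : ℕ) (w : ℂ → ℂ) : Prop :=
  MemLp w 2 volume ∧
    ∃ wn : ℝ → ℂ, ∀ᵐ x : ℂ, w x = wn ‖x‖ * Complex.exp (Complex.I * n * Complex.arg x)

/-- `Ω` is radially symmetric. -/
def IsVortex (Ω : ℂ → ℝ) : Prop := ∃ W : ℝ → ℝ, ∀ x : ℂ, Ω x = W ‖x‖

/-- The vortex `Ω` is unstable: for some `n ≥ 1`, the operator `L` has an eigenfunction
`0 ≠ w ∈ U_n` with an eigenvalue `μ` of positive real part. -/
def IsUnstable (Ω : ℂ → ℝ) : Prop :=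
  ∃ n : ℕ, 1 ≤ n ∧ ∃ (μ : ℂ) (w : ℂ → ℂ), 0 < μ.re ∧ MemU n w ∧ ¬ (∀ᵐ x : ℂ, w x = 0) ∧
    IsLinearizedEuler Ω w (fun x => μ * w x)

end Euler2D

end

/-!
The vortex is a rigid rotation inside the unit disc and rest outside a slightly larger disc,
joined by a thin shear layer. As the layer gets thinner it tends to a vortex sheet, whose modes of
wave number `ν > 1` have the phase speeds `c` with `(ν - 1)(1 - c)² + (ν + 1) c² = 0`. These are
not real, so one of them grows. Written for the radial displacement and its momentum, Rayleigh's
equation in the layer `r = 1 + ετ` contains no derivative of the angular velocity `Z`, so it is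
regular at `ε = 0`, and since `c` is a simple root the implicit function theorem continues the
growing mode to some `ε > 0`.

In the plane, the fluxes `r ^ (±ν) (r ψ' ∓ ν ψ)` of the stream function `ψ` are primitives of the
densities of the inner and outer Biot–Savart integrals, which identifies `ψ` with the stream
function of the vorticity of the mode. The mean of the vortex vanishes because the circulation
`2 π r² Z` does so outside the layer.
-/

noncomputable section

namespace Euler2D

open Set Filter Topology unitInterval ComplexConjugate Real

section Primitive

/-- The primitive vanishing at `0` of a continuous function on the unit interval, as a bounded
operator. -/
def primitive : C(I, ℂ) →L[ℂ] C(I, ℂ) :=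
  LinearMap.mkContinuous
    { toFun g := ⟨fun τ => ∫ t in (0 : ℝ)..τ, g (projIcc 0 1 zero_le_one t), by
        have hg : Continuous fun t : ℝ => g (projIcc 0 1 zero_le_one t) := by fun_prop
        exact (intervalIntegral.continuous_primitive
          (fun a b => hg.intervalIntegrable a b) 0).comp continuous_subtype_val⟩
      map_add' g h := by
        ext τ
        exact intervalIntegral.integral_add (Continuous.intervalIntegrable (by fun_prop) _ _)
          (Continuous.intervalIntegrable (by fun_prop) _ _)
      map_smul' a g := by
        ext τ
        simp }
    1 fun g => by
      rw [one_mul, ContinuousMap.norm_le _ (norm_nonneg g)]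
      intro τ
      have h := intervalIntegral.norm_integral_le_of_norm_le_const (a := (0 : ℝ)) (b := τ)
        (f := fun t => g (projIcc 0 1 zero_le_one t)) (C := ‖g‖) fun t _ => g.norm_coe_le_norm _
      rw [sub_zero, abs_of_nonneg τ.2.1] at h
      exact h.trans (mul_le_of_le_one_right (norm_nonneg g) τ.2.2)

lemma primitive_apply (g : C(I, ℂ)) (τ : I) :
    primitive g τ = ∫ t in (0 : ℝ)..τ, g (projIcc 0 1 zero_le_one t) := rfl

lemma primitive_zero (g : C(I, ℂ)) : primitive g 0 = 0 := by simp [primitive_apply]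

lemma hasDerivAt_primitive (g : C(I, ℂ)) {τ : ℝ} (hτ : τ ∈ Ioo (0 : ℝ) 1) :
    HasDerivAt (fun t => primitive g (projIcc 0 1 zero_le_one t))
      (g (projIcc 0 1 zero_le_one τ)) τ := by
  have hg : Continuous fun t : ℝ => g (projIcc 0 1 zero_le_one t) := by fun_prop
  refine (intervalIntegral.integral_hasDerivAt_right (hg.intervalIntegrable 0 τ)
    (hg.stronglyMeasurableAtFilter _ _) hg.continuousAt).congr_of_eventuallyEq ?_
  filter_upwards [Ioo_mem_nhds hτ.1 hτ.2] with t ht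
  rw [primitive_apply, projIcc_of_mem _ (Ioo_subset_Icc_self ht)]

end Primitive

section Rescale

/-- A function on the unit interval transplanted to the interval `[1, 1 + ε]` and extended by
constants. -/
def rescale (ε : ℝ) (g : C(I, ℂ)) (r : ℝ) : ℂ := g (projIcc 0 1 zero_le_one ((r - 1) / ε))

variable {ε : ℝ} {f g : C(I, ℂ)}

lemma continuous_rescale : Continuous (rescale ε g) := by
  unfold rescale
  fun_prop

lemma rescale_one : rescale ε g 1 = g 0 := by
  simp [rescale]

lemma rescale_one_add (hε : ε ≠ 0) : rescale ε g (1 + ε) = g 1 := by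
  rw [rescale, add_sub_cancel_left, div_self hε, projIcc_right]
  rfl

lemma hasDerivAt_rescale {b : ℂ} (hfg : ∀ τ, f τ = b + ε * primitive g τ) {r : ℝ}
    (hr : r ∈ Ioo 1 (1 + ε)) : HasDerivAt (rescale ε f) (rescale ε g r) r := by
  have hε : 0 < ε := by linarith [hr.1, hr.2]
  have hτ : (r - 1) / ε ∈ Ioo (0 : ℝ) 1 :=
    ⟨div_pos (by linarith [hr.1]) hε, (div_lt_one hε).2 (by linarith [hr.2])⟩
  have hτ' : HasDerivAt (fun r => (r - 1) / ε) (1 / ε) r :=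
    ((hasDerivAt_id r).sub_const 1).div_const ε
  have h := (((hasDerivAt_primitive g hτ).scomp r hτ').const_mul (ε : ℂ)).const_add b
  have hεc : (ε : ℂ) ≠ 0 := Complex.ofReal_ne_zero.2 hε.ne'
  have hf : rescale ε f = fun r => b + ε * primitive g (projIcc 0 1 zero_le_one ((r - 1) / ε)) :=
    funext fun _ => hfg _
  rw [hf]
  refine h.congr_deriv ?_
  rw [Complex.real_smul, rescale]
  push_cast
  field_simp

end Rescale

section ShearLayer

/-- The coordinate function of the unit interval. -/
def coordI : C(I, ℂ) := ⟨fun τ => ((τ : ℝ) : ℂ), by fun_prop⟩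

/-- The angular velocity across the layer: it falls smoothly from `1` to `0`. -/
def stepI : C(I, ℂ) := ⟨fun τ => ((1 - Real.smoothTransition τ : ℝ) : ℂ), by
  have := Real.smoothTransition.continuous
  fun_prop⟩

/-- Unknowns of the Rayleigh problem in the layer: the radial displacement of the fluid, its
momentum, and the phase speed. -/
abbrev LayerSpace := C(I, ℂ) × C(I, ℂ) × ℂ

/-- The radial derivative `p / (r³ (Z - c)²)` of the displacement, in a layer `r = 1 + ετ`. -/
def displacementSlope : ℂ × LayerSpace → C(I, ℂ)
  | (ε, _, p, c) => p * Ring.inverse ((1 + ε • coordI) ^ 3 * (stepI - c • 1) ^ 2)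

/-- The radial derivative `(ν² - 1) r (Z - c)² f` of the momentum, in a layer `r = 1 + ετ`. -/
def momentumSlope (ν : ℝ) : ℂ × LayerSpace → C(I, ℂ)
  | (ε, f, _, c) => ((ν : ℂ) ^ 2 - 1) • ((1 + ε • coordI) * (stepI - c • 1) ^ 2 * f)

/-- The Rayleigh problem of wave number `ν` in the layer `1 ≤ r ≤ 1 + ε`, as the zeros of a map: two
integrated differential equations with their initial values, and the boundary condition at
`r = 1 + ε`. -/
def layerMap (ν : ℝ) : ℂ × LayerSpace → LayerSpace
  | (ε, f, p, c) =>
    (f - 1 - ε • primitive (displacementSlope (ε, f, p, c)),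
      p - ((ν - 1) * (1 - c) ^ 2) • 1 - ε • primitive (momentumSlope ν (ε, f, p, c)),
      p 1 + (ν + 1) * (1 + ε) ^ 2 * c ^ 2 * f 1)

/-- The phase speed of the growing mode of a vortex sheet, the limit of a thin layer. -/
def sheetSpeed (ν : ℝ) : ℂ := ⟨(ν - 1) / (2 * ν), √(ν ^ 2 - 1) / (2 * ν)⟩

/-- The growing mode of a vortex sheet, in the layer variables. -/
def sheetMode (ν : ℝ) : LayerSpace :=
  (1, ((ν - 1) * (1 - sheetSpeed ν) ^ 2) • 1, sheetSpeed ν)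

variable {ν : ℝ}

lemma sheetSpeed_im_pos (hν : 1 < ν) : 0 < (sheetSpeed ν).im := by
  have : 0 < ν ^ 2 - 1 := by nlinarith
  simp only [sheetSpeed]
  positivity

lemma sheetSpeed_dispersion (hν : 1 < ν) :
    (ν - 1) * (1 - sheetSpeed ν) ^ 2 + (ν + 1) * sheetSpeed ν ^ 2 = 0 := by
  have hsq : √(ν ^ 2 - 1) ^ 2 = ν ^ 2 - 1 := Real.sq_sqrt (by nlinarith)
  have hν0 : (ν : ℂ) ≠ 0 := Complex.ofReal_ne_zero.2 (by linarith)
  have hc : sheetSpeed ν = (ν - 1 + √(ν ^ 2 - 1) * Complex.I) / (2 * ν) := by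
    rw [sheetSpeed, Complex.mk_eq_add_mul_I]
    push_cast
    ring
  have hsq' : (√(ν ^ 2 - 1) : ℂ) ^ 2 = ν ^ 2 - 1 := by exact_mod_cast hsq
  rw [hc]
  field_simp
  linear_combination (2 * ν : ℂ) * Complex.I ^ 2 * hsq' + 2 * ν * (ν ^ 2 - 1) * Complex.I_sq

lemma sheetSpeed_dispersion_deriv_ne_zero (hν : 1 < ν) :
    2 * (2 * ν * sheetSpeed ν - (ν - 1)) ≠ 0 := by
  intro h
  have him : ν = 0 ∨ (sheetSpeed ν).im = 0 := by simpa using congrArg Complex.im h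
  exact him.elim (fun h0 => by linarith) (sheetSpeed_im_pos hν).ne'

lemma layerMap_sheetMode (hν : 1 < ν) : layerMap ν (0, sheetMode ν) = 0 := by
  refine Prod.ext ?_ (Prod.ext ?_ ?_)
  · ext τ; simp [layerMap, sheetMode]
  · ext τ; simp [layerMap, sheetMode]
  · simpa [layerMap, sheetMode] using sheetSpeed_dispersion hν

lemma stepI_sub_apply (c : ℂ) (τ : I) :
    (stepI - c • 1) τ = (1 - Real.smoothTransition τ : ℝ) - c := by
  simp [stepI]

lemma stepI_sub_ne_zero {c : ℂ} (hc : 0 < c.im) (τ : I) : (stepI - c • 1) τ ≠ 0 := by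
  intro h
  have him := congrArg Complex.im h
  rw [stepI_sub_apply, Complex.sub_im, Complex.ofReal_im, zero_sub, Complex.zero_im] at him
  linarith

lemma isUnit_slopeDenominator {ε : ℝ} (hε : 0 ≤ ε) {c : ℂ} (hc : 0 < c.im) :
    IsUnit ((1 + (ε : ℂ) • coordI) ^ 3 * (stepI - c • 1) ^ 2) := by
  refine (ContinuousMap.isUnit_iff_forall_ne_zero _).2 fun τ =>
    mul_ne_zero (pow_ne_zero 3 ?_) (pow_ne_zero 2 (stepI_sub_ne_zero hc τ))
  have h : (1 + (ε : ℂ) • coordI) τ = ((1 + ε * τ : ℝ) : ℂ) := by simp [coordI]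
  rw [h, Complex.ofReal_ne_zero]
  have := mul_nonneg hε τ.2.1
  positivity

lemma contDiffAt_layerMap (hν : 1 < ν) : ContDiffAt ℂ 1 (layerMap ν) (0, sheetMode ν) := by
  set u₀ : ℂ × LayerSpace := (0, sheetMode ν)
  have hden : ContDiff ℂ 1 fun u : ℂ × LayerSpace =>
      (1 + u.1 • coordI) ^ 3 * (stepI - u.2.2.2 • 1) ^ 2 := by fun_prop
  have hinv : ContDiffAt ℂ 1 (fun u : ℂ × LayerSpace =>
      Ring.inverse ((1 + u.1 • coordI) ^ 3 * (stepI - u.2.2.2 • 1) ^ 2)) u₀ := by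
    obtain ⟨d, hd⟩ := isUnit_slopeDenominator le_rfl (sheetSpeed_im_pos hν)
    have h := contDiffAt_ringInverse ℂ (n := 1) d
    rw [hd, Complex.ofReal_zero] at h
    exact h.comp u₀ hden.contDiffAt
  have hdisp : ContDiffAt ℂ 1 displacementSlope u₀ :=
    (show ContDiffAt ℂ 1 (fun u : ℂ × LayerSpace => u.2.2.1) u₀ by fun_prop).mul hinv
  have hmom : ContDiff ℂ 1 (momentumSlope ν) := by
    change ContDiff ℂ 1 fun u : ℂ × LayerSpace =>
      ((ν : ℂ) ^ 2 - 1) • ((1 + u.1 • coordI) * (stepI - u.2.2.2 • 1) ^ 2 * u.2.1)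
    fun_prop
  have heval : ContDiff ℂ 1 fun g : C(I, ℂ) => g 1 :=
    (ContinuousMap.evalCLM ℂ (1 : I) : C(I, ℂ) →L[ℂ] ℂ).contDiff
  have hdisp' := primitive.contDiff.contDiffAt.comp u₀ hdisp
  have hmom' := primitive.contDiff.comp hmom
  have hf₁ := heval.comp (show ContDiff ℂ 1 fun u : ℂ × LayerSpace => u.2.1 by fun_prop)
  have hp₁ := heval.comp (show ContDiff ℂ 1 fun u : ℂ × LayerSpace => u.2.2.1 by fun_prop)
  change ContDiffAt ℂ 1 (fun u : ℂ × LayerSpace =>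
    (u.2.1 - 1 - u.1 • (primitive ∘ displacementSlope) u,
      u.2.2.1 - ((ν - 1) * (1 - u.2.2.2) ^ 2) • (1 : C(I, ℂ)) -
        u.1 • (primitive ∘ momentumSlope ν) u,
      u.2.2.1 1 + (ν + 1) * (1 + u.1) ^ 2 * u.2.2.2 ^ 2 * u.2.1 1)) u₀
  simp only [Function.comp_def] at hf₁ hp₁ hmom'
  fun_prop

lemma exists_hasFDerivAt_layerMap_zero (ν : ℝ) : ∃ D : LayerSpace →L[ℂ] LayerSpace,
    HasFDerivAt (fun y => layerMap ν (0, y)) D (sheetMode ν) ∧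
      ∀ f p c, D (f, p, c) = (f, p + (2 * (ν - 1) * (1 - sheetSpeed ν) * c) • 1,
        p 1 + (ν + 1) * (2 * sheetSpeed ν * c + sheetSpeed ν ^ 2 * f 1)) := by
  have hf := hasFDerivAt_fst (𝕜 := ℂ) (p := sheetMode ν)
  have hpc := hasFDerivAt_snd (𝕜 := ℂ) (p := sheetMode ν)
  have hp := hpc.fst
  have hc := hpc.snd
  have heval (g : C(I, ℂ)) := (ContinuousMap.evalCLM ℂ (1 : I)).hasFDerivAt (x := g)
  have hend := ((heval _).comp _ hp).add
    (((hc.pow 2).const_mul ((ν : ℂ) + 1)).mul ((heval _).comp _ hf))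
  have hp' := hp.sub ((((hc.const_sub 1).pow 2).const_mul ((ν : ℂ) - 1)).smul_const (1 : C(I, ℂ)))
  refine ⟨_, ((hf.sub_const 1).prodMk (hp'.prodMk hend)).congr_of_eventuallyEq
    (Eventually.of_forall fun y => ?_), fun f p c => ?_⟩
  · refine Prod.ext ?_ (Prod.ext ?_ ?_)
    · ext τ; simp [layerMap]
    · ext τ; simp [layerMap]
    · simp [layerMap]
  · refine Prod.ext ?_ (Prod.ext ?_ ?_)
    · simp
    · ext τ
      simp only [sheetMode, Nat.add_one_sub_one, pow_one, nsmul_eq_mul, Nat.cast_ofNat, smul_neg,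
        ContinuousLinearMap.prod_apply, sub_apply, ContinuousLinearMap.comp_apply,
        ContinuousLinearMap.coe_fst', ContinuousLinearMap.coe_snd',
        ContinuousLinearMap.smulRight_apply, neg_apply, smul_apply, smul_eq_mul, neg_smul,
        sub_neg_eq_add, ContinuousMap.add_apply, ContinuousMap.coe_smul, ContinuousMap.coe_one,
        Pi.smul_apply, Pi.one_apply, mul_one, add_right_inj]
      ring
    · simp only [sheetMode, Nat.add_one_sub_one, pow_one, nsmul_eq_mul, Nat.cast_ofNat, smul_neg,
        Function.comp_apply, ContinuousMap.evalCLM_apply, ContinuousMap.one_apply, one_smul,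
        ContinuousLinearMap.prod_apply, ContinuousLinearMap.coe_fst', sub_apply,
        ContinuousLinearMap.comp_apply, ContinuousLinearMap.coe_snd',
        ContinuousLinearMap.smulRight_apply, neg_apply, smul_apply, smul_eq_mul, neg_smul,
        sub_neg_eq_add, add_apply, add_right_inj]
      ring

lemma bijective_of_apply_eq (hν : 1 < ν) {D : LayerSpace →L[ℂ] LayerSpace}
    (hD : ∀ f p c, D (f, p, c) = (f, p + (2 * (ν - 1) * (1 - sheetSpeed ν) * c) • 1,
      p 1 + (ν + 1) * (2 * sheetSpeed ν * c + sheetSpeed ν ^ 2 * f 1))) :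
    Function.Bijective D := by
  set c₀ := sheetSpeed ν
  have hsimple : 2 * (2 * ν * c₀ - (ν - 1)) ≠ 0 := sheetSpeed_dispersion_deriv_ne_zero hν
  refine ⟨(injective_iff_map_eq_zero D).2 ?_, ?_⟩
  · rintro ⟨f, p, c⟩ h
    simp only [hD, Prod.mk_eq_zero] at h
    obtain ⟨rfl, hp, hend⟩ := h
    have hp₁ : p 1 + 2 * (ν - 1) * (1 - c₀) * c = 0 := by
      simpa using congrArg (fun g : C(I, ℂ) => g 1) hp
    have hc : 2 * (2 * ν * c₀ - (ν - 1)) * c = 0 := by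
      simp only [ContinuousMap.zero_apply] at hend
      linear_combination hend - hp₁
    obtain rfl : c = 0 := (mul_eq_zero.1 hc).resolve_left hsimple
    have hp₀ : p = 0 := by
      ext τ
      simpa using congrArg (fun g : C(I, ℂ) => g τ) hp
    rw [hp₀]
    rfl
  · rintro ⟨f, p, e⟩
    obtain ⟨c, hc⟩ : ∃ c, 2 * (2 * ν * c₀ - (ν - 1)) * c = e - p 1 - (ν + 1) * c₀ ^ 2 * f 1 :=
      ⟨_, mul_div_cancel₀ _ hsimple⟩
    refine ⟨(f, p - (2 * (ν - 1) * (1 - c₀) * c) • 1, c), ?_⟩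
    rw [hD]
    refine Prod.ext rfl (Prod.ext (sub_add_cancel _ _) ?_)
    simp only [ContinuousMap.sub_apply, ContinuousMap.smul_apply, ContinuousMap.one_apply,
      smul_eq_mul, mul_one]
    linear_combination hc

lemma isInvertible_partialDeriv_layerMap (hν : 1 < ν) :
    (fderiv ℂ (layerMap ν) (0, sheetMode ν) ∘L .inr ℂ ℂ LayerSpace).IsInvertible := by
  obtain ⟨D, hD, hD_apply⟩ := exists_hasFDerivAt_layerMap_zero ν
  have hD_eq : fderiv ℂ (layerMap ν) (0, sheetMode ν) ∘L .inr ℂ ℂ LayerSpace = D :=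
    (((contDiffAt_layerMap hν).differentiableAt one_ne_zero).hasFDerivAt.comp (sheetMode ν)
      (hasFDerivAt_prodMk_right 0 (sheetMode ν))).unique hD
  have hbij := bijective_of_apply_eq hν hD_apply
  rw [hD_eq]
  exact ⟨.ofBijective D (LinearMap.ker_eq_bot.2 hbij.1) (LinearMap.range_eq_top.2 hbij.2), rfl⟩

theorem exists_layerMap_eq_zero (hν : 1 < ν) :
    ∃ ε : ℝ, 0 < ε ∧ ∃ f p c, 0 < c.im ∧ layerMap ν (ε, f, p, c) = 0 := by
  have hstrict := (contDiffAt_layerMap hν).hasStrictFDerivAt one_ne_zero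
  have hinv := isInvertible_partialDeriv_layerMap hν
  have hzero := hstrict.eventually_apply_implicitFunctionOfProdDomain hinv
  have him := (hstrict.tendsto_implicitFunctionOfProdDomain hinv).eventually
    ((isOpen_lt continuous_const
      (by fun_prop : Continuous fun y : LayerSpace => y.2.2.im)).mem_nhds (sheetSpeed_im_pos hν))
  have hcast : Tendsto (fun ε : ℝ => (ε : ℂ)) (𝓝[>] 0) (𝓝 0) :=
    (Complex.continuous_ofReal.tendsto 0).mono_left nhdsWithin_le_nhds
  obtain ⟨ε, ⟨hεzero, hεim⟩, hε⟩ :=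
    ((hcast.eventually (hzero.and him)).and self_mem_nhdsWithin).exists
  exact ⟨ε, hε, _, _, _, hεim, hεzero.trans (layerMap_sheetMode hν)⟩

end ShearLayer

section UnstableProfile

/-- A vortex with angular velocity `Z r` at the radius `r`, which rotates rigidly for `r ≤ 1` and is
at rest for `r ≥ R`, together with a growing mode of angular wave number `ν`. The phase speed of the
mode is `c`; its stream function is `r (Z - c) F e^{iν(θ - ct)}`, where `F` is the radial
displacement of the fluid, and `p = r³ (Z - c)² F'` is the momentum. The boundary values of `p`
match the stream function to the harmonic functions `r^ν e^{iνθ}` for `r ≤ 1` and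
`r^{-ν} e^{iνθ}` for `r ≥ R`. -/
structure UnstableProfile (ν : ℝ) where
  /-- The angular velocity. -/
  Z : ℝ → ℝ
  /-- The radius outside which the fluid is at rest. -/
  R : ℝ
  /-- The phase speed. -/
  c : ℂ
  /-- The radial displacement. -/
  F : ℝ → ℂ
  /-- The momentum. -/
  p : ℝ → ℂ
  contDiff_Z : ContDiff ℝ ∞ Z
  one_lt_R : 1 < R
  Z_inner : ∀ r ≤ 1, Z r = 1
  Z_outer : ∀ r, R ≤ r → Z r = 0
  c_im_pos : 0 < c.im
  continuous_F : Continuous F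
  continuous_p : Continuous p
  hasDerivAt_F : ∀ r ∈ Ioo 1 R, HasDerivAt F (p r / (r ^ 3 * (Z r - c) ^ 2)) r
  hasDerivAt_p : ∀ r ∈ Ioo 1 R, HasDerivAt p ((ν ^ 2 - 1) * (r * (Z r - c) ^ 2 * F r)) r
  F_one : F 1 = 1
  p_one : p 1 = (ν - 1) * (1 - c) ^ 2
  p_R : p R = -(ν + 1) * R ^ 2 * c ^ 2 * F R

/-- The angular velocity `1` smoothly cut off in the layer `1 ≤ r ≤ 1 + ε`. -/
def layerVelocity (ε r : ℝ) : ℝ := 1 - Real.smoothTransition ((r - 1) / ε)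

variable {ν ε : ℝ} {f p : C(I, ℂ)} {c : ℂ}

lemma contDiff_layerVelocity : ContDiff ℝ ∞ (layerVelocity ε) :=
  contDiff_const.sub (Real.smoothTransition.contDiff.comp (by fun_prop))

lemma layerVelocity_of_le_one (hε : 0 ≤ ε) {r : ℝ} (hr : r ≤ 1) : layerVelocity ε r = 1 := by
  rw [layerVelocity, Real.smoothTransition.zero_of_nonpos
    (div_nonpos_of_nonpos_of_nonneg (by linarith) hε), sub_zero]

lemma layerVelocity_of_one_add_le (hε : 0 < ε) {r : ℝ} (hr : 1 + ε ≤ r) :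
    layerVelocity ε r = 0 := by
  rw [layerVelocity, Real.smoothTransition.one_of_one_le ((one_le_div hε).2 (by linarith)),
    sub_self]

lemma rescale_stepI (r : ℝ) : rescale ε stepI r = layerVelocity ε r := by
  simp [rescale, stepI, layerVelocity]

lemma rescale_radius {r : ℝ} (hr : r ∈ Ioo 1 (1 + ε)) :
    rescale ε (1 + (ε : ℂ) • coordI) r = r := by
  have hε : 0 < ε := by linarith [hr.1, hr.2]
  have hτ : (r - 1) / ε ∈ Icc (0 : ℝ) 1 :=
    ⟨div_nonneg (by linarith [hr.1]) hε.le, (div_le_one hε).2 (by linarith [hr.2])⟩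
  have hεc : (ε : ℂ) ≠ 0 := Complex.ofReal_ne_zero.2 hε.ne'
  rw [rescale, projIcc_of_mem _ hτ]
  simp [coordI, mul_div_cancel₀ _ hεc]

lemma rescale_displacementSlope (hc : 0 < c.im) {r : ℝ} (hr : r ∈ Ioo 1 (1 + ε)) :
    rescale ε (displacementSlope (ε, f, p, c)) r =
      rescale ε p r / (r ^ 3 * (layerVelocity ε r - c) ^ 2) := by
  have hunit := isUnit_slopeDenominator (by linarith [hr.1, hr.2] : 0 ≤ ε) hc
  set τ := projIcc 0 1 zero_le_one ((r - 1) / ε) with hτ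
  have hne := (ContinuousMap.isUnit_iff_forall_ne_zero _).1 hunit τ
  have hinv : _ * _ = (1 : ℂ) := congrArg (fun g : C(I, ℂ) => g τ) (Ring.mul_inverse_cancel _ hunit)
  rw [← rescale_stepI, ← rescale_radius hr]
  simp only [ContinuousMap.mul_apply, ContinuousMap.pow_apply, ContinuousMap.sub_apply,
    ContinuousMap.smul_apply, ContinuousMap.one_apply, smul_eq_mul, mul_one] at hne
  rw [rescale, rescale, rescale, rescale, ← hτ, eq_div_iff hne]
  simp only [displacementSlope, ContinuousMap.mul_apply, ContinuousMap.pow_apply,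
    ContinuousMap.sub_apply, ContinuousMap.smul_apply, ContinuousMap.one_apply, smul_eq_mul,
    mul_one] at hinv ⊢
  linear_combination p τ * hinv

lemma rescale_momentumSlope {r : ℝ} (hr : r ∈ Ioo 1 (1 + ε)) :
    rescale ε (momentumSlope ν (ε, f, p, c)) r =
      (ν ^ 2 - 1) * (r * (layerVelocity ε r - c) ^ 2 * rescale ε f r) := by
  rw [← rescale_stepI, ← rescale_radius hr]
  simp [momentumSlope, rescale]

theorem nonempty_unstableProfile (hν : 1 < ν) : Nonempty (UnstableProfile ν) := by
  obtain ⟨ε, hε, f, p, c, hc, h⟩ := exists_layerMap_eq_zero hν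
  simp only [layerMap, Prod.mk_eq_zero] at h
  obtain ⟨hf, hp, hend⟩ := h
  have hf_apply (τ) : f τ = 1 + ε * primitive (displacementSlope (ε, f, p, c)) τ := by
    simpa [sub_eq_zero, sub_eq_iff_eq_add'] using congrArg (fun g : C(I, ℂ) => g τ) hf
  have hp_apply (τ) :
      p τ = (ν - 1) * (1 - c) ^ 2 + ε * primitive (momentumSlope ν (ε, f, p, c)) τ := by
    simpa [sub_eq_zero, sub_eq_iff_eq_add'] using congrArg (fun g : C(I, ℂ) => g τ) hp
  exact ⟨{
    Z := layerVelocity ε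
    R := 1 + ε
    c := c
    F := rescale ε f
    p := rescale ε p
    contDiff_Z := contDiff_layerVelocity
    one_lt_R := by linarith
    Z_inner := fun r hr => layerVelocity_of_le_one hε.le hr
    Z_outer := fun r hr => layerVelocity_of_one_add_le hε hr
    c_im_pos := hc
    continuous_F := continuous_rescale
    continuous_p := continuous_rescale
    hasDerivAt_F := fun r hr =>
      (hasDerivAt_rescale hf_apply hr).congr_deriv (rescale_displacementSlope hc hr)
    hasDerivAt_p := fun r hr =>
      (hasDerivAt_rescale hp_apply hr).congr_deriv (rescale_momentumSlope hr)
    F_one := by rw [rescale_one, hf_apply, primitive_zero, mul_zero, add_zero]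
    p_one := by rw [rescale_one, hp_apply, primitive_zero, mul_zero, add_zero]
    p_R := by
      rw [rescale_one_add hε.ne', rescale_one_add hε.ne']
      push_cast
      linear_combination hend }⟩

end UnstableProfile

section CircleAverage

variable {E : Type*} [NormedAddCommGroup E] [NormedSpace ℝ E]

lemma polarCoord_symm_eq_circleMap (q : ℝ × ℝ) :
    Complex.polarCoord.symm q = circleMap 0 q.1 q.2 := by
  rw [Complex.polarCoord_symm_apply, circleMap_zero, Complex.exp_mul_I]
  push_cast
  ring

lemma integrableOn_smul_circleMap {f : ℂ → E} (hf : Integrable f) :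
    IntegrableOn (fun q : ℝ × ℝ => q.1 • f (circleMap 0 q.1 q.2)) (Ioi 0 ×ˢ Ioo (-π) π) := by
  have hf' : Integrable (f ∘ Complex.measurableEquivRealProd.symm) :=
    Complex.volume_preserving_equiv_real_prod.symm.integrable_comp_emb
      Complex.measurableEquivRealProd.symm.measurableEmbedding |>.2 hf
  have hpolar := (integrableOn_image_iff_integrableOn_abs_det_fderiv_smul volume
    polarCoord.open_target.measurableSet
    (fun q _ => (hasFDerivAt_polarCoord_symm q).hasFDerivWithinAt) polarCoord.symm.injOn
    (f ∘ Complex.measurableEquivRealProd.symm)).1 hf'.integrableOn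
  refine hpolar.congr_fun (fun q hq => ?_) polarCoord.open_target.measurableSet
  have hq0 : 0 < q.1 := hq.1
  simp only [Function.comp, det_fderivPolarCoordSymm, abs_of_pos hq0,
    Complex.measurableEquivRealProd_symm_polarCoord_symm_apply, polarCoord_symm_eq_circleMap]

theorem integral_eq_integral_circleAverage {f : ℂ → E} (hf : Integrable f) :
    ∫ x, f x = (2 * π) • ∫ r in Ioi (0 : ℝ), r • circleAverage f 0 r := by
  have hpolar : ∫ x, f x = ∫ q in Ioi (0 : ℝ) ×ˢ Ioo (-π) π, q.1 • f (circleMap 0 q.1 q.2) := by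
    simp only [← Complex.integral_comp_polarCoord_symm, polarCoord_symm_eq_circleMap]
    rfl
  rw [hpolar, Measure.volume_eq_prod, setIntegral_prod _ (integrableOn_smul_circleMap hf),
    ← integral_smul]
  refine setIntegral_congr_fun measurableSet_Ioi fun r _ => ?_
  have hπ : -π ≤ π := by linarith [pi_pos]
  have h := circleAverage_eq_integral_add (f := f) (c := 0) (R := r) (-π)
  rw [h, intervalIntegral.integral_comp_add_right (fun θ => f (circleMap 0 r θ)), zero_add,
    two_mul, add_neg_cancel_right, ← two_mul, integral_smul, ← integral_Ioc_eq_integral_Ioo,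
    ← intervalIntegral.integral_of_le hπ, smul_comm, smul_inv_smul₀ (by positivity)]

lemma circleAverage_div_sub_mul_pow_of_lt {a : ℂ} {r : ℝ} (h : ‖a‖ < r) (m : ℕ) :
    circleAverage (fun z => z / (z - a) * z ^ m) 0 r = a ^ m := by
  have hd : DiffContOnCl ℂ (fun z : ℂ => z ^ m) (Metric.ball 0 |r|) :=
    (differentiable_pow m).diffContOnCl
  simpa using hd.circleAverage_smul_div (w := a) (by simpa using h.trans_le (le_abs_self r))

lemma circleAverage_div_sub_mul_pow_of_gt {a : ℂ} {r : ℝ} (hr : 0 ≤ r) (h : r < ‖a‖) (m : ℕ) :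
    circleAverage (fun z => z / (z - a) * z ^ m) 0 r = 0 := by
  have hne : ∀ z ∈ Metric.closedBall (0 : ℂ) |r|, z - a ≠ 0 := by
    rintro z hz hza
    rw [mem_closedBall_zero_iff, abs_of_nonneg hr, sub_eq_zero.1 hza] at hz
    exact absurd hz h.not_ge
  have hd : DiffContOnCl ℂ (fun z : ℂ => z / (z - a) * z ^ m) (Metric.ball 0 |r|) :=
    DifferentiableOn.diffContOnCl_ball (by fun_prop (disch := assumption)) subset_rfl
  rw [hd.circleAverage, zero_div, zero_mul]

end CircleAverage

section Angular

variable {m : ℕ} {g : ℝ → ℂ} {R : ℝ}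

/-- The function `r ^ m g(r) e^{imθ}` of angular wave number `m`. -/
def angular (m : ℕ) (g : ℝ → ℂ) (y : ℂ) : ℂ := y ^ m * g ‖y‖

lemma continuous_angular (hg : Continuous g) : Continuous (angular m g) := by
  unfold angular
  fun_prop

lemma hasCompactSupport_of_norm {E : Type*} [Zero E] {w : ℂ → E}
    (h : ∀ y, R ≤ ‖y‖ → w y = 0) : HasCompactSupport w :=
  .of_support_subset_isCompact (isCompact_closedBall (0 : ℂ) R) fun y hy =>
    mem_closedBall_zero_iff.2 (le_of_not_ge fun hR => hy (h y hR))

lemma hasCompactSupport_angular (hg : ∀ r, R ≤ r → g r = 0) :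
    HasCompactSupport (angular m g) :=
  hasCompactSupport_of_norm fun y hy => by rw [angular, hg _ hy, mul_zero]

lemma circleAverage_mul_angular (k : ℂ → ℂ) {r : ℝ} (hr : 0 ≤ r) :
    circleAverage (fun y => k y * angular m g y) 0 r =
      g r * circleAverage (fun y => k y * y ^ m) 0 r := by
  rw [← smul_eq_mul, ← circleAverage_fun_smul]
  refine circleAverage_congr_sphere fun y hy => ?_
  rw [mem_sphere_zero_iff_norm, abs_of_nonneg hr] at hy
  simp only [angular, hy, smul_eq_mul]
  ring

end Angular

section CauchyTransform

lemma integrable_smul_of_norm_le_norm_inv {𝕜 F : Type*} [RCLike 𝕜] [NormedAddCommGroup F]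
    [NormedSpace 𝕜 F] {k : ℂ → 𝕜} (hk : Measurable k) (hk_le : ∀ z, ‖k z‖ ≤ ‖z‖⁻¹) {w : ℂ → F}
    (hw : Continuous w) (hs : HasCompactSupport w) (x : ℂ) :
    Integrable fun y => k (x - y) • w y := by
  have hloc : LocallyIntegrable k :=
    locallyIntegrable_of_norm_le_rpow (C := 1) (α := 1) (by simp) (by simp)
      (Eventually.of_forall fun z => by simpa [Real.rpow_neg_one] using hk_le z)
      hk.aestronglyMeasurable
  have h := hloc.integrable_smul_right_of_hasCompactSupport
    (show Continuous fun z => w (x - z) by fun_prop) (hs.comp_homeomorph (Homeomorph.subLeft x))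
  simpa using h.comp_sub_left x

/-- The Cauchy transform of `w`, a multiple of the solution `u` of `∂u/∂z̄ = w`. -/
def cauchyTransform (w : ℂ → ℂ) (x : ℂ) : ℂ := ∫ y, (x - y)⁻¹ * w y

/-- The Cauchy transform with the conjugate kernel, a multiple of the solution `u` of
`∂u/∂z = w`. -/
def conjCauchyTransform (w : ℂ → ℂ) (x : ℂ) : ℂ := ∫ y, conj (x - y)⁻¹ * w y

variable {w : ℂ → ℂ}

lemma integrable_cauchyTransform (hw : Continuous w) (hs : HasCompactSupport w) (x : ℂ) :
    Integrable fun y => (x - y)⁻¹ * w y :=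
  integrable_smul_of_norm_le_norm_inv (k := fun z : ℂ => z⁻¹) (by fun_prop) (by simp) hw hs x

lemma integrable_conjCauchyTransform (hw : Continuous w) (hs : HasCompactSupport w) (x : ℂ) :
    Integrable fun y => conj (x - y)⁻¹ * w y :=
  integrable_smul_of_norm_le_norm_inv (k := fun z : ℂ => conj z⁻¹) (by fun_prop) (by simp) hw hs x

lemma circleAverage_inv_sub_mul_pow {x : ℂ} {r : ℝ} (hr : 0 ≤ r) (hne : r ≠ ‖x‖) (m : ℕ) :
    circleAverage (fun y => (x - y)⁻¹ * y ^ (m + 1)) 0 r =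
      (Ioi ‖x‖).indicator (fun _ => -x ^ m) r := by
  have h : (fun y => (x - y)⁻¹ * y ^ (m + 1)) = fun y => -1 * (y / (y - x) * y ^ m) := by
    ext y
    rw [← neg_sub y x, inv_neg]
    ring
  simp only [h, ← smul_eq_mul (-1 : ℂ), circleAverage_fun_smul]
  rcases hne.lt_or_gt with hlt | hgt
  · rw [circleAverage_div_sub_mul_pow_of_gt hr hlt, smul_zero,
      indicator_of_notMem (notMem_Ioi.2 hlt.le)]
  · rw [circleAverage_div_sub_mul_pow_of_lt hgt, indicator_of_mem (mem_Ioi.2 hgt), smul_eq_mul,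
      neg_one_mul]

lemma circleAverage_conj_inv_sub_mul_pow {x : ℂ} {r : ℝ} (hr : 0 < r) (hx : x ≠ 0)
    (hne : r ≠ ‖x‖) (m : ℕ) :
    circleAverage (fun y => conj (x - y)⁻¹ * y ^ m) 0 r =
      (Iio ‖x‖).indicator (fun r => (r ^ (2 * m) / conj x ^ (m + 1) : ℂ)) r := by
  have hx' : conj x ≠ 0 := by simpa using hx
  have hnorm : ‖(r ^ 2 / conj x : ℂ)‖ = r ^ 2 / ‖x‖ := by simp
  -- On the circle `|y| = r`, the function `conj y` is `r² / y`.
  have h : circleAverage (fun y => conj (x - y)⁻¹ * y ^ m) 0 r =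
      circleAverage (fun y => (conj x)⁻¹ • (y / (y - r ^ 2 / conj x) * y ^ m)) 0 r := by
    refine circleAverage_congr_sphere fun y hy => ?_
    rw [mem_sphere_zero_iff_norm, abs_of_pos hr] at hy
    have hy0 : y ≠ 0 := norm_pos_iff.1 (hy ▸ hr)
    have hconj : conj y = r ^ 2 / y := by
      rw [eq_div_iff hy0, mul_comm, Complex.mul_conj, Complex.normSq_eq_norm_sq, hy]
      push_cast
      rfl
    have hsub : conj (x - y) = conj x * (y - r ^ 2 / conj x) / y := by
      rw [map_sub, hconj]
      field_simp
    simp only [map_inv₀, hsub, smul_eq_mul, div_eq_mul_inv, mul_inv, inv_inv]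
    ring
  rw [h, circleAverage_fun_smul]
  rcases hne.lt_or_gt with hlt | hgt
  · rw [circleAverage_div_sub_mul_pow_of_lt, indicator_of_mem (mem_Iio.2 hlt),
      smul_eq_mul, div_pow, pow_mul]
    · field_simp
      ring
    · rw [hnorm, div_lt_iff₀ (by positivity)]
      nlinarith
  · rw [circleAverage_div_sub_mul_pow_of_gt hr.le, smul_zero,
      indicator_of_notMem (notMem_Iio.2 hgt.le)]
    rw [hnorm, lt_div_iff₀ (by positivity)]
    nlinarith

variable {m : ℕ} {g : ℝ → ℂ}

theorem cauchyTransform_angular_succ (hg : Continuous g)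
    (hs : HasCompactSupport (angular (m + 1) g)) (x : ℂ) :
    cauchyTransform (angular (m + 1) g) x =
      -(2 * π) * x ^ m * ∫ r in Ioi ‖x‖, r * g r := by
  rw [cauchyTransform, integral_eq_integral_circleAverage
    (integrable_cauchyTransform (continuous_angular hg) hs x)]
  have h : ∫ r in Ioi (0 : ℝ), r • circleAverage (fun y => (x - y)⁻¹ * angular (m + 1) g y) 0 r =
      ∫ r in Ioi (0 : ℝ), (Ioi ‖x‖).indicator (fun r => -x ^ m * (r * g r)) r := by
    refine setIntegral_congr_ae measurableSet_Ioi ?_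
    filter_upwards [Measure.ae_ne volume ‖x‖] with r hne hr
    rw [circleAverage_mul_angular _ (le_of_lt hr), circleAverage_inv_sub_mul_pow (le_of_lt hr) hne,
      indicator_apply, indicator_apply, Complex.real_smul]
    split_ifs <;> ring
  rw [h, setIntegral_indicator measurableSet_Ioi,
    inter_eq_right.2 (Ioi_subset_Ioi (norm_nonneg x)), integral_const_mul, Complex.real_smul]
  push_cast
  ring

theorem conjCauchyTransform_angular (hg : Continuous g) (hs : HasCompactSupport (angular m g))
    {x : ℂ} (hx : x ≠ 0) :
    conjCauchyTransform (angular m g) x =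
      2 * π / conj x ^ (m + 1) * ∫ r in 0..‖x‖, r ^ (2 * m + 1) * g r := by
  rw [conjCauchyTransform, integral_eq_integral_circleAverage
    (integrable_conjCauchyTransform (continuous_angular hg) hs x)]
  have h : ∫ r in Ioi (0 : ℝ), r • circleAverage (fun y => conj (x - y)⁻¹ * angular m g y) 0 r =
      ∫ r in Ioi (0 : ℝ), (Iio ‖x‖).indicator
        (fun r => 1 / conj x ^ (m + 1) * (r ^ (2 * m + 1) * g r)) r := by
    refine setIntegral_congr_ae measurableSet_Ioi ?_
    filter_upwards [Measure.ae_ne volume ‖x‖] with r hne hr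
    rw [circleAverage_mul_angular _ (le_of_lt hr), circleAverage_conj_inv_sub_mul_pow hr hx hne,
      indicator_apply, indicator_apply, Complex.real_smul]
    split_ifs <;> ring
  rw [h, setIntegral_indicator measurableSet_Iio, Ioi_inter_Iio, ← integral_Ioc_eq_integral_Ioo,
    ← intervalIntegral.integral_of_le (norm_nonneg x), intervalIntegral.integral_const_mul,
    Complex.real_smul]
  push_cast
  ring

end CauchyTransform

section Velocity

lemma kernel_eq (z : ℂ) : kernel z = Complex.I / (2 * π) * conj z⁻¹ := by
  rcases eq_or_ne z 0 with rfl | hz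
  · simp [kernel]
  have hz' : conj z ≠ 0 := by simpa using hz
  have hnorm : ((‖z‖ : ℝ) : ℂ) ^ 2 = z * conj z := by
    rw [Complex.mul_conj, Complex.normSq_eq_norm_sq, Complex.ofReal_pow]
  rw [kernel, map_inv₀]
  push_cast
  rw [hnorm]
  field_simp

lemma norm_kernel_le (z : ℂ) : ‖kernel z‖ ≤ ‖z‖⁻¹ := by
  rw [kernel_eq, norm_mul, RCLike.norm_conj, norm_inv]
  refine mul_le_of_le_one_left (by positivity) ?_
  rw [norm_div, Complex.norm_I, div_le_one (by simp [pi_ne_zero])]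
  simp only [Complex.norm_mul, Complex.norm_ofNat, Complex.norm_real, norm_eq_abs]
  linarith [pi_gt_three, le_abs_self π]

lemma measurable_kernel : Measurable kernel := by
  unfold kernel
  fun_prop

lemma hasVelocity_of_continuous {F : Type*} [NormedAddCommGroup F] [NormedSpace ℝ F] {w : ℂ → F}
    (hw : Continuous w) (hs : HasCompactSupport w) : HasVelocity w :=
  Eventually.of_forall fun x =>
    ⟨integrable_smul_of_norm_le_norm_inv (Complex.measurable_re.comp measurable_kernel)
      (fun z => (Complex.abs_re_le_norm _).trans (norm_kernel_le z)) hw hs x,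
    integrable_smul_of_norm_le_norm_inv (Complex.measurable_im.comp measurable_kernel)
      (fun z => (Complex.abs_im_le_norm _).trans (norm_kernel_le z)) hw hs x⟩

lemma velocity_eq_cauchyTransform {w : ℂ → ℂ} (hw : Continuous w) (hs : HasCompactSupport w)
    (x : ℂ) :
    velocity w x = (Complex.I / (4 * π) * (conjCauchyTransform w x - cauchyTransform w x),
      1 / (4 * π) * (conjCauchyTransform w x + cauchyTransform w x)) := by
  have hC := integrable_cauchyTransform hw hs x
  have hC' := integrable_conjCauchyTransform hw hs x
  rw [velocity, conjCauchyTransform, cauchyTransform, ← integral_sub hC' hC,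
    ← integral_add hC' hC, ← integral_const_mul, ← integral_const_mul]
  congr 1 <;> refine integral_congr_ae (Eventually.of_forall fun y => ?_)
  · simp only [Complex.real_smul, Complex.re_eq_add_conj, kernel_eq, map_mul, map_div₀,
      Complex.conj_I, Complex.conj_ofReal, map_ofNat, Complex.conj_conj]
    field_simp
    ring
  · simp only [Complex.real_smul, Complex.im_eq_sub_conj, kernel_eq, map_mul, map_div₀,
      Complex.conj_I, Complex.conj_ofReal, map_ofNat, Complex.conj_conj]
    field_simp
    ring

lemma velocity_ofReal (Ω : ℂ → ℝ) (x : ℂ) :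
    velocity (fun y => (Ω y : ℂ)) x = (((velocity Ω x).1 : ℂ), ((velocity Ω x).2 : ℂ)) := by
  simp only [velocity, smul_eq_mul, Complex.real_smul, ← Complex.ofReal_mul]
  exact Prod.ext integral_ofReal integral_ofReal

/-- The velocity of the vorticity `Ω` is a rotation about the origin, of angular velocity `Z r` on
the circle of radius `r > 0`. -/
def HasAngularVelocity (Ω : ℂ → ℝ) (Z : ℝ → ℝ) : Prop :=
  ∀ x ≠ 0, velocity Ω x = (-(Z ‖x‖ * x.im), Z ‖x‖ * x.re)

lemma hasAngularVelocity_radial {W : ℝ → ℝ} (hW : Continuous W)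
    (hs : HasCompactSupport fun y : ℂ => W ‖y‖) :
    HasAngularVelocity (fun y => W ‖y‖) fun r => (∫ t in 0..r, t * W t) / r ^ 2 := by
  intro x hx
  set v := velocity (fun y : ℂ => W ‖y‖) x
  set ζ : ℝ := (∫ t in 0..‖x‖, t * W t) / ‖x‖ ^ 2 with hζ
  have hang : angular 0 (fun r => (W r : ℂ)) = fun y : ℂ => ((W ‖y‖ : ℝ) : ℂ) := by
    ext y
    rw [angular, pow_zero, one_mul]
  have hWc : Continuous fun r => (W r : ℂ) := by fun_prop
  have hsc : HasCompactSupport (angular 0 fun r => (W r : ℂ)) :=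
    hang ▸ hs.comp_left (g := Complex.ofReal) Complex.ofReal_zero
  have hv := velocity_eq_cauchyTransform (continuous_angular hWc) hsc x
  rw [hang, velocity_ofReal, ← hang, Prod.mk.injEq] at hv
  have hpi : (π : ℂ) ≠ 0 := Complex.ofReal_ne_zero.2 pi_ne_zero
  have hx' : conj x ≠ 0 := by simpa using hx
  have hnorm : ((‖x‖ : ℝ) : ℂ) ^ 2 = x * conj x := by
    rw [Complex.mul_conj, Complex.normSq_eq_norm_sq, Complex.ofReal_pow]
  have hsum : (v.1 : ℂ) + v.2 * Complex.I = Complex.I * x * ζ := by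
    rw [hv.1, hv.2, conjCauchyTransform_angular hWc hsc hx, hζ]
    push_cast [← intervalIntegral.integral_ofReal]
    rw [hnorm]
    simp only [pow_one]
    field_simp
    ring
  have hre := congrArg Complex.re hsum
  have him := congrArg Complex.im hsum
  simp only [Complex.add_re, Complex.add_im, Complex.mul_re, Complex.mul_im, Complex.ofReal_re,
    Complex.ofReal_im, Complex.I_re, Complex.I_im] at hre him
  exact Prod.ext (by linarith) (by linarith)

theorem re_smul_add_im_smul_velocity_angular {n : ℕ} (hn : n ≠ 0) {g : ℝ → ℂ} (hg : Continuous g)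
    (hs : HasCompactSupport (angular n g)) {x : ℂ} (hx : x ≠ 0) :
    x.re • (velocity (angular n g) x).1 + x.im • (velocity (angular n g) x).2 =
      Complex.I / 2 * (x ^ n * (∫ r in Ioi ‖x‖, r * g r) +
        1 / conj x ^ n * ∫ r in 0..‖x‖, r ^ (2 * n + 1) * g r) := by
  obtain ⟨m, rfl⟩ : ∃ m, n = m + 1 := Nat.exists_eq_succ_of_ne_zero hn
  have hx' : conj x ≠ 0 := by simpa using hx
  have hpi : (π : ℂ) ≠ 0 := Complex.ofReal_ne_zero.2 pi_ne_zero
  set a := cauchyTransform (angular (m + 1) g) x with ha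
  set b := conjCauchyTransform (angular (m + 1) g) x with hb
  calc
    _ = Complex.I / (4 * π) * (conj x * b - x * a) := by
      rw [velocity_eq_cauchyTransform (continuous_angular hg) hs, Complex.real_smul,
        Complex.real_smul, Complex.re_eq_add_conj, Complex.im_eq_sub_conj, ← ha, ← hb]
      field_simp
      linear_combination (x - conj x) * (b + a) * Complex.I_sq
    _ = _ := by
      rw [ha, hb, cauchyTransform_angular_succ hg hs, conjCauchyTransform_angular hg hs hx]
      field_simp
      ring

end Velocity

section Transport

lemma integral_eq_zero_of_hasDerivAt_circleMap {E : Type*} [NormedAddCommGroup E]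
    [NormedSpace ℝ E] [CompleteSpace E] {f G : ℂ → E} (hf : Continuous f)
    (h : ∀ r θ, HasDerivAt (fun θ => G (circleMap 0 r θ)) (f (circleMap 0 r θ)) θ) :
    ∫ x, f x = 0 := by
  by_cases hint : Integrable f
  · have havg (r : ℝ) : circleAverage f 0 r = 0 := by
      rw [circleAverage_def, intervalIntegral.integral_eq_sub_of_hasDerivAt (fun θ _ => h r θ)
        (Continuous.intervalIntegrable (by fun_prop) _ _), ← zero_add (2 * π),
        periodic_circleMap 0 r 0, sub_self, smul_zero]
    simp [integral_eq_integral_circleAverage hint, havg]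
  · exact integral_undef hint

lemma hasDerivAt_angular_circleMap (m : ℕ) (g : ℝ → ℂ) (r θ : ℝ) :
    HasDerivAt (fun θ => angular m g (circleMap 0 r θ))
      (m * Complex.I * angular m g (circleMap 0 r θ)) θ := by
  simp only [angular, norm_circleMap_zero]
  refine (((hasDerivAt_circleMap 0 r θ).pow m).mul_const _).congr_deriv ?_
  cases m with
  | zero => simp
  | succ m =>
    simp only [Nat.add_sub_cancel]
    ring

lemma integral_fderiv_mul_I_smul_angular {φ : ℂ → ℝ} (hφ : ContDiff ℝ 1 φ)
    (hφs : HasCompactSupport φ) {m : ℕ} {g : ℝ → ℂ} (hg : Continuous g) :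
    ∫ x, fderiv ℝ φ x (x * Complex.I) • angular m g x =
      ∫ x, φ x • (-(m * Complex.I) * angular m g x) := by
  have hw := continuous_angular (m := m) hg
  have hφc := hφ.continuous
  have hφ' : Continuous fun x => fderiv ℝ φ x (x * Complex.I) :=
    (hφ.continuous_fderiv one_ne_zero).clm_apply (by fun_prop)
  have hφs' : HasCompactSupport fun x => fderiv ℝ φ x (x * Complex.I) :=
    (hφs.fderiv ℝ).mono fun x hx h => hx (by simp [h])
  have h₁ : Integrable fun x => φ x • (m * Complex.I * angular m g x) :=
    Continuous.integrable_of_hasCompactSupport (by fun_prop) hφs.smul_right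
  have h₂ : Integrable fun x => fderiv ℝ φ x (x * Complex.I) • angular m g x :=
    (hφ'.smul hw).integrable_of_hasCompactSupport hφs'.smul_right
  have h := integral_eq_zero_of_hasDerivAt_circleMap (G := fun x => φ x • angular m g x)
    (f := fun x => φ x • (m * Complex.I * angular m g x) +
      fderiv ℝ φ x (x * Complex.I) • angular m g x) (by fun_prop) fun r θ =>
      ((hφ.differentiable one_ne_zero).differentiableAt.hasFDerivAt.comp_hasDerivAt θ
        (hasDerivAt_circleMap 0 r θ)).smul (hasDerivAt_angular_circleMap m g r θ)
  rw [integral_add h₁ h₂] at h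
  simp only [neg_mul, smul_neg, integral_neg]
  exact eq_neg_of_add_eq_zero_right h

theorem isTransport_angular {Ω : ℂ → ℝ} {Z : ℝ → ℝ} (hΩ : HasAngularVelocity Ω Z)
    (hZ : Continuous Z) {m : ℕ} {g : ℝ → ℂ} (hg : Continuous g) :
    IsTransport Ω (angular m g) fun x => -(m * Complex.I) * Z ‖x‖ * angular m g x := by
  intro φ hφ hφs
  have hZg (x : ℂ) : angular m (fun r => Z r * g r) x = Z ‖x‖ * angular m g x := by
    simp only [angular]
    ring
  have hrot := integral_fderiv_mul_I_smul_angular (hφ.of_le (by norm_cast)) hφs (m := m)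
    (g := fun r => Z r * g r) (by fun_prop)
  simp only [hZg] at hrot
  simp only [mul_assoc] at hrot ⊢
  rw [← hrot]
  refine integral_congr_ae ?_
  filter_upwards [Measure.ae_ne volume 0] with x hx
  have hxI : x * Complex.I = (-x.im) • (1 : ℂ) + x.re • Complex.I := by
    apply Complex.ext <;> simp
  rw [hΩ x hx, partialX, partialY, hxI, map_add, map_smul, map_smul]
  simp only [smul_eq_mul, Complex.real_smul]
  push_cast
  ring

end Transport

section Vortex

lemma contDiff_comp_norm {E : Type*} [NormedAddCommGroup E] [InnerProductSpace ℝ E]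
    {F : Type*} [NormedAddCommGroup F] [NormedSpace ℝ F] {k : WithTop ℕ∞} {W : ℝ → F} {a : F}
    (hW : ContDiff ℝ k W) (h : ∀ᶠ r in 𝓝 0, W r = a) : ContDiff ℝ k fun x : E => W ‖x‖ := by
  refine contDiff_iff_contDiffAt.2 fun x => ?_
  rcases eq_or_ne x 0 with rfl | hx
  · have hlim : Tendsto (norm : E → ℝ) (𝓝 0) (𝓝 0) := tendsto_norm_zero
    exact (contDiffAt_const (c := a)).congr_of_eventuallyEq (hlim.eventually h)
  · exact hW.contDiffAt.comp x (contDiffAt_norm ℝ hx)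

lemma deriv_eq_zero_of_eqOn_const {F : Type*} [NormedAddCommGroup F] [NormedSpace ℝ F] {f : ℝ → F}
    {s : Set ℝ} {a : F} {r : ℝ} (hs : UniqueDiffOn ℝ s) (hf : Differentiable ℝ f)
    (h : ∀ r ∈ s, f r = a) (hr : r ∈ s) : deriv f r = 0 :=
  (hs r hr).eq_deriv s (hf r).hasDerivAt.hasDerivWithinAt
    ((hasDerivWithinAt_const r s a).congr h (h r hr))

/-- The vorticity, at the radius `r`, of the rotation with angular velocity `Z`: its product with
`r` is the derivative of the circulation `r² Z r`. -/
def vorticity (Z : ℝ → ℝ) (r : ℝ) : ℝ := 2 * Z r + r * deriv Z r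

/-- The vorticity of the rotation with angular velocity `Z`, as a function on the plane. -/
def vortex (Z : ℝ → ℝ) (x : ℂ) : ℝ := vorticity Z ‖x‖

variable {Z : ℝ → ℝ} {R : ℝ}

lemma contDiff_vorticity (hZ : ContDiff ℝ ∞ Z) : ContDiff ℝ ∞ (vorticity Z) :=
  (contDiff_const.mul hZ).add (contDiff_id.mul (contDiff_infty_iff_deriv.1 hZ).2)

lemma hasDerivAt_deriv (hZ : ContDiff ℝ ∞ Z) (r : ℝ) :
    HasDerivAt (deriv Z) (deriv (deriv Z) r) r :=
  ((contDiff_infty_iff_deriv.1 hZ).2.differentiable (by simp) r).hasDerivAt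

lemma deriv_vorticity (hZ : ContDiff ℝ ∞ Z) (r : ℝ) :
    deriv (vorticity Z) r = 3 * deriv Z r + r * deriv (deriv Z) r := by
  have hd : HasDerivAt Z (deriv Z r) r := (hZ.differentiable (by simp) r).hasDerivAt
  refine ((hd.const_mul 2).add ((hasDerivAt_id r).mul (hasDerivAt_deriv hZ r))).deriv.trans ?_
  simp only [id_eq]
  ring

lemma vorticity_of_eqOn_const {s : Set ℝ} {a r : ℝ} (hs : UniqueDiffOn ℝ s)
    (hZ : Differentiable ℝ Z) (h : ∀ r ∈ s, Z r = a) (hr : r ∈ s) : vorticity Z r = 2 * a := by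
  rw [vorticity, h r hr, deriv_eq_zero_of_eqOn_const hs hZ h hr, mul_zero, add_zero]

lemma deriv_vorticity_of_eqOn_const {s : Set ℝ} {a r : ℝ} (hs : UniqueDiffOn ℝ s)
    (hZ : ContDiff ℝ ∞ Z) (h : ∀ r ∈ s, Z r = a) (hr : r ∈ s) : deriv (vorticity Z) r = 0 :=
  deriv_eq_zero_of_eqOn_const hs ((contDiff_vorticity hZ).differentiable (by simp))
    (fun _ => vorticity_of_eqOn_const hs (hZ.differentiable (by simp)) h) hr

lemma integral_mul_vorticity (hZ : ContDiff ℝ ∞ Z) (r : ℝ) :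
    ∫ t in 0..r, t * vorticity Z t = r ^ 2 * Z r := by
  have h (t : ℝ) : HasDerivAt (fun t => t ^ 2 * Z t) (t * vorticity Z t) t := by
    have hd : HasDerivAt Z (deriv Z t) t := (hZ.differentiable (by simp) t).hasDerivAt
    refine ((hasDerivAt_pow 2 t).mul hd).congr_deriv ?_
    rw [vorticity]
    ring
  have hc := (contDiff_vorticity hZ).continuous
  rw [intervalIntegral.integral_eq_sub_of_hasDerivAt (fun t _ => h t)
    (Continuous.intervalIntegrable (by fun_prop) _ _)]
  ring

lemma contDiff_vortex {a : ℝ} (hZ : ContDiff ℝ ∞ Z) (h : ∀ᶠ r in 𝓝 0, Z r = a) :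
    ContDiff ℝ ∞ (vortex Z) := by
  refine contDiff_comp_norm (contDiff_vorticity hZ) (a := 2 * a) ?_
  have hd : deriv Z =ᶠ[𝓝 0] deriv fun _ => a := EventuallyEq.deriv h
  filter_upwards [h, hd] with r hr hr'
  rw [vorticity, hr, hr', deriv_const, mul_zero, add_zero]

lemma hasAngularVelocity_vortex (hZ : ContDiff ℝ ∞ Z) (hs : HasCompactSupport (vortex Z)) :
    HasAngularVelocity (vortex Z) Z := by
  intro x hx
  have hx' : ‖x‖ ^ 2 ≠ 0 := pow_ne_zero 2 (norm_ne_zero_iff.2 hx)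
  have h := hasAngularVelocity_radial (contDiff_vorticity hZ).continuous hs x hx
  simp only [integral_mul_vorticity hZ, mul_div_cancel_left₀ _ hx'] at h
  exact h

lemma hasCompactSupport_vortex (hZ : Differentiable ℝ Z) (h : ∀ r, R ≤ r → Z r = 0) :
    HasCompactSupport (vortex Z) :=
  hasCompactSupport_of_norm fun _ hy => by
    rw [vortex, vorticity_of_eqOn_const (uniqueDiffOn_Ici R) hZ h hy, mul_zero]

lemma hasFDerivAt_norm {E : Type*} [NormedAddCommGroup E] [InnerProductSpace ℝ E] {x : E}
    (hx : x ≠ 0) : HasFDerivAt (norm : E → ℝ) (‖x‖⁻¹ • innerSL ℝ x) x := by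
  have hx' : ‖x‖ ^ 2 ≠ 0 := pow_ne_zero 2 (norm_ne_zero_iff.2 hx)
  have h := (hasStrictFDerivAt_norm_sq x).hasFDerivAt.sqrt hx'
  simp only [Real.sqrt_sq (norm_nonneg _)] at h
  refine h.congr_fderiv ?_
  rw [← Nat.cast_smul_eq_nsmul ℝ, smul_smul]
  congr 1
  field_simp
  norm_num

lemma fderiv_vortex (hZ : ContDiff ℝ ∞ Z) {x : ℂ} (hx : x ≠ 0) (v : ℂ) :
    fderiv ℝ (vortex Z) x v = deriv (vorticity Z) ‖x‖ / ‖x‖ * (x.re * v.re + x.im * v.im) := by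
  have hd : HasDerivAt (vorticity Z) (deriv (vorticity Z) ‖x‖) ‖x‖ :=
    ((contDiff_vorticity hZ).differentiable (by simp) _).hasDerivAt
  have h : fderiv ℝ (vortex Z) x = _ := (hd.comp_hasFDerivAt x (hasFDerivAt_norm hx)).fderiv
  simp only [h, smul_apply, coe_innerSL_apply, Complex.inner, Complex.mul_re, Complex.conj_re,
    Complex.conj_im, smul_eq_mul]
  ring

lemma integral_vortex (hZ : ContDiff ℝ ∞ Z) (hR : 0 ≤ R) (h : ∀ r, R ≤ r → Z r = 0) :
    ∫ x, vortex Z x = 0 := by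
  have hdiff := hZ.differentiable (by simp)
  have hint : Integrable (vortex Z) :=
    ((contDiff_vorticity hZ).continuous.comp continuous_norm).integrable_of_hasCompactSupport
      (hasCompactSupport_vortex hdiff h)
  have havg : ∀ r ∈ Ioi (0 : ℝ), r • circleAverage (vortex Z) 0 r = r * vorticity Z r := by
    intro r hr
    have hc : circleAverage (vortex Z) 0 r = circleAverage (fun _ => vorticity Z r) 0 r :=
      circleAverage_congr_sphere fun y hy => by
        rw [mem_sphere_zero_iff_norm, abs_of_pos hr] at hy
        rw [vortex, hy]
    rw [hc, circleAverage_const, smul_eq_mul]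
  have hzero : ∀ r ∈ Ioi (0 : ℝ) \ Ioc 0 R, r * vorticity Z r = 0 := by
    intro r hr
    have hRr : R ≤ r := le_of_not_ge fun hle => hr.2 ⟨hr.1, hle⟩
    rw [vorticity_of_eqOn_const (uniqueDiffOn_Ici R) hdiff h hRr, mul_zero, mul_zero]
  rw [integral_eq_integral_circleAverage hint, setIntegral_congr_fun measurableSet_Ioi havg,
    setIntegral_eq_of_subset_of_forall_sdiff_eq_zero measurableSet_Ioi Ioc_subset_Ioi_self hzero,
    ← intervalIntegral.integral_of_le hR, integral_mul_vorticity hZ, h R le_rfl, mul_zero,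
    smul_zero]

end Vortex

namespace UnstableProfile

section Flux

variable {ν : ℝ} (P : UnstableProfile ν)

lemma Z_sub_c_ne_zero (r : ℝ) : (P.Z r - P.c : ℂ) ≠ 0 := fun h =>
  P.c_im_pos.ne' (by simpa using congrArg Complex.im h)

lemma differentiable_Z : Differentiable ℝ P.Z := P.contDiff_Z.differentiable (by simp)

lemma hasDerivAt_Z (r : ℝ) : HasDerivAt (fun r => (P.Z r : ℂ)) (deriv P.Z r : ℝ) r :=
  (P.differentiable_Z r).hasDerivAt.ofReal_comp

lemma continuous_deriv_Z : Continuous (deriv P.Z) :=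
  (contDiff_infty_iff_deriv.1 P.contDiff_Z).2.continuous

/-- The radial factor `ψ` of the stream function of the mode. -/
def stream (r : ℝ) : ℂ := r * (P.Z r - P.c) * P.F r

/-- The expression `r ^ b (r ψ' - b ψ)`, where `ψ` is the stream function; for `b = ±ν` it
vanishes where `ψ` is a multiple of the harmonic function `r ^ b`. -/
def flux (b : ℤ) (r : ℝ) : ℂ :=
  r ^ b * (r ^ 2 * (deriv P.Z r : ℝ) * P.F r + P.p r / (r * (P.Z r - P.c)) +
    (1 - b) * (r * (P.Z r - P.c) * P.F r))

lemma flux_div_sub_flux_neg (n : ℕ) {r : ℝ} (hr : r ≠ 0) :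
    P.flux n r / r ^ (2 * n) - P.flux (-n) r = -2 * n * P.stream r / r ^ n := by
  have hr' : (r : ℂ) ≠ 0 := Complex.ofReal_ne_zero.2 hr
  have hA := P.Z_sub_c_ne_zero r
  simp only [flux, stream, zpow_neg, zpow_natCast]
  push_cast
  field_simp
  ring

lemma hasDerivAt_flux {b : ℤ} (hb : (b : ℝ) ^ 2 = ν ^ 2) {r : ℝ} (hr : r ∈ Ioo 1 P.R) :
    HasDerivAt (P.flux b) (r ^ (b + 1) * (deriv (vorticity P.Z) r : ℝ) * P.F r) r := by
  have hr' : (r : ℂ) ≠ 0 := Complex.ofReal_ne_zero.2 (by linarith [hr.1])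
  have hb' : (b : ℂ) ^ 2 = (ν : ℂ) ^ 2 := by exact_mod_cast hb
  have hZ0 := P.Z_sub_c_ne_zero r
  have hid : HasDerivAt (fun r : ℝ => (r : ℂ)) 1 r := Complex.ofRealCLM.hasDerivAt
  have hpow := (hasDerivAt_zpow b (r : ℂ) (.inl hr')).comp_ofReal
  have hF := P.hasDerivAt_F r hr
  have hA := (P.hasDerivAt_Z r).sub_const P.c
  have hψ := (hid.mul hA).mul hF
  have h := hpow.mul (((((hid.pow 2).mul (hasDerivAt_deriv P.contDiff_Z r).ofReal_comp).mul hF).add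
    ((P.hasDerivAt_p r hr).div (hid.mul hA) (mul_ne_zero hr' hZ0))).add
      (hψ.const_mul (1 - b : ℂ)))
  refine h.congr_deriv ?_
  rw [deriv_vorticity P.contDiff_Z, zpow_add_one₀ hr', zpow_sub_one₀ hr']
  simp only [Pi.mul_apply, Pi.pow_apply, Pi.add_apply, Pi.div_apply]
  push_cast
  field_simp
  rw [← hb']
  ring

lemma continuousOn_flux (b : ℤ) : ContinuousOn (P.flux b) (Icc 1 P.R) := by
  have hZ := P.contDiff_Z.continuous
  have hZ' := P.continuous_deriv_Z
  have hF := P.continuous_F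
  have hp := P.continuous_p
  have hr : ∀ r ∈ Icc 1 P.R, (r : ℂ) ≠ 0 := fun r hr =>
    Complex.ofReal_ne_zero.2 (by linarith [hr.1])
  have hA : ∀ r ∈ Icc 1 P.R, (r : ℂ) * (P.Z r - P.c) ≠ 0 := fun r h =>
    mul_ne_zero (hr r h) (P.Z_sub_c_ne_zero r)
  unfold flux
  refine ContinuousOn.mul (ContinuousOn.zpow₀ (by fun_prop) _ fun r h => .inl (hr r h)) ?_
  exact ((by fun_prop : Continuous _).continuousOn.add
    (hp.continuousOn.div (by fun_prop) hA)).add (by fun_prop : Continuous _).continuousOn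

end Flux

variable {n : ℕ} (P : UnstableProfile n)

lemma flux_natCast_one : P.flux n 1 = 0 := by
  have hZ0 := P.Z_sub_c_ne_zero 1
  have hd : deriv P.Z 1 = 0 :=
    deriv_eq_zero_of_eqOn_const (uniqueDiffOn_Iic 1) P.differentiable_Z P.Z_inner self_mem_Iic
  rw [P.Z_inner 1 le_rfl] at hZ0
  rw [flux, hd, P.Z_inner 1 le_rfl, P.F_one, P.p_one]
  push_cast at hZ0 ⊢
  field_simp
  ring

lemma flux_neg_R : P.flux (-n) P.R = 0 := by
  have hZ0 := P.Z_sub_c_ne_zero P.R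
  have hR : (P.R : ℂ) ≠ 0 := Complex.ofReal_ne_zero.2 (by linarith [P.one_lt_R])
  have hd : deriv P.Z P.R = 0 :=
    deriv_eq_zero_of_eqOn_const (uniqueDiffOn_Ici P.R) P.differentiable_Z P.Z_outer self_mem_Ici
  rw [P.Z_outer P.R le_rfl, Complex.ofReal_zero, zero_sub] at hZ0
  rw [flux, hd, P.Z_outer P.R le_rfl, P.p_R]
  push_cast
  rw [zero_sub]
  field_simp
  ring

lemma deriv_vorticity_inner {r : ℝ} (hr : r ≤ 1) : deriv (vorticity P.Z) r = 0 :=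
  deriv_vorticity_of_eqOn_const (uniqueDiffOn_Iic 1) P.contDiff_Z P.Z_inner hr

lemma deriv_vorticity_outer {r : ℝ} (hr : P.R ≤ r) : deriv (vorticity P.Z) r = 0 :=
  deriv_vorticity_of_eqOn_const (uniqueDiffOn_Ici P.R) P.contDiff_Z P.Z_outer hr

/-- The radial factor of the vorticity of the mode with `r ^ n` divided out, as `angular n` supplies
it; `max r 1` avoids dividing by `0` where the vorticity vanishes anyway. -/
def mode (r : ℝ) : ℂ := (deriv (vorticity P.Z) r : ℝ) * P.F r / (max r 1 : ℝ) ^ n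

/-- The vorticity of the mode. -/
def eigenfunction : ℂ → ℂ := angular n P.mode

lemma mode_of_one_le {r : ℝ} (hr : 1 ≤ r) :
    P.mode r = (deriv (vorticity P.Z) r : ℝ) * P.F r / r ^ n := by
  rw [mode, max_eq_left hr]

lemma mode_inner {r : ℝ} (hr : r ≤ 1) : P.mode r = 0 := by
  rw [mode, P.deriv_vorticity_inner hr, Complex.ofReal_zero, zero_mul, zero_div]

lemma mode_outer {r : ℝ} (hr : P.R ≤ r) : P.mode r = 0 := by
  rw [mode, P.deriv_vorticity_outer hr, Complex.ofReal_zero, zero_mul, zero_div]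

lemma continuous_mode : Continuous P.mode := by
  have hF := P.continuous_F
  have hW := (contDiff_infty_iff_deriv.1 (contDiff_vorticity P.contDiff_Z)).2.continuous
  have hmax (r : ℝ) : ((max r 1 : ℝ) : ℂ) ^ n ≠ 0 :=
    pow_ne_zero n (Complex.ofReal_ne_zero.2 (by positivity))
  unfold mode
  fun_prop (disch := exact hmax)

lemma integral_mode_inner {r : ℝ} (hr : r ∈ Icc 1 P.R) :
    ∫ t in 0..r, (t : ℂ) ^ (2 * n + 1) * P.mode t = P.flux n r := by
  have hc : Continuous fun t : ℝ => (t : ℂ) ^ (2 * n + 1) * P.mode t := by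
    have := P.continuous_mode
    fun_prop
  have hzero : ∫ t in (0 : ℝ)..1, (t : ℂ) ^ (2 * n + 1) * P.mode t = 0 := by
    refine (intervalIntegral.integral_congr (g := fun _ => 0) fun t ht => ?_).trans (by simp)
    rw [uIcc_of_le zero_le_one] at ht
    simp only [P.mode_inner ht.2, mul_zero]
  have hderiv : ∀ t ∈ Ioo 1 r, HasDerivAt (P.flux n) ((t : ℂ) ^ (2 * n + 1) * P.mode t) t := by
    intro t ht
    have ht' : (t : ℂ) ≠ 0 := Complex.ofReal_ne_zero.2 (by linarith [ht.1])
    refine (P.hasDerivAt_flux (by simp) ⟨ht.1, ht.2.trans_le hr.2⟩).congr_deriv ?_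
    rw [P.mode_of_one_le ht.1.le, zpow_add_one₀ ht', zpow_natCast]
    field_simp
    ring
  rw [← intervalIntegral.integral_add_adjacent_intervals (hc.intervalIntegrable 0 1)
    (hc.intervalIntegrable 1 r), hzero, zero_add,
    intervalIntegral.integral_eq_sub_of_hasDerivAt_of_le hr.1
      ((P.continuousOn_flux n).mono (Icc_subset_Icc_right hr.2)) hderiv (hc.intervalIntegrable 1 r),
    P.flux_natCast_one, sub_zero]

lemma integral_mode_outer {r : ℝ} (hr : r ∈ Icc 1 P.R) :
    ∫ t in Ioi r, t * P.mode t = -P.flux (-n) r := by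
  have hc : Continuous fun t : ℝ => t * P.mode t := by
    have := P.continuous_mode
    fun_prop
  have hzero : ∀ t ∈ Ioi r \ Ioc r P.R, t * P.mode t = 0 := fun t ht => by
    rw [P.mode_outer (le_of_not_ge fun hle => ht.2 ⟨ht.1, hle⟩), mul_zero]
  have hderiv : ∀ t ∈ Ioo r P.R, HasDerivAt (P.flux (-n)) (t * P.mode t) t := by
    intro t ht
    have ht1 : 1 < t := hr.1.trans_lt ht.1
    have ht' : (t : ℂ) ≠ 0 := Complex.ofReal_ne_zero.2 (by linarith)
    refine (P.hasDerivAt_flux (by simp) ⟨ht1, ht.2⟩).congr_deriv ?_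
    rw [P.mode_of_one_le ht1.le, zpow_add_one₀ ht', zpow_neg, zpow_natCast]
    field_simp
  rw [setIntegral_eq_of_subset_of_forall_sdiff_eq_zero measurableSet_Ioi Ioc_subset_Ioi_self hzero,
    ← intervalIntegral.integral_of_le hr.2, intervalIntegral.integral_eq_sub_of_hasDerivAt_of_le
      hr.2 ((P.continuousOn_flux _).mono (Icc_subset_Icc_left hr.1)) hderiv
      (hc.intervalIntegrable _ _), P.flux_neg_R, zero_sub]

/-- The left side is `‖x‖` times the radial velocity, the right side `-∂ψ/∂θ` for the stream
function `ψ` of the mode. -/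
lemma re_smul_add_im_smul_velocity_eigenfunction (hn : n ≠ 0) {x : ℂ} (hx : ‖x‖ ∈ Icc 1 P.R) :
    x.re • (velocity P.eigenfunction x).1 + x.im • (velocity P.eigenfunction x).2 =
      -(n * Complex.I) * x ^ n * (P.stream ‖x‖ / ‖x‖ ^ n) := by
  have hr : ‖x‖ ≠ 0 := by linarith [hx.1]
  have hx0 : x ≠ 0 := norm_ne_zero_iff.1 hr
  have hconj : conj x ≠ 0 := by simpa using hx0
  have hnorm : (‖x‖ : ℂ) ^ 2 = x * conj x := by
    rw [Complex.mul_conj, Complex.normSq_eq_norm_sq, Complex.ofReal_pow]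
  have hpow : 1 / conj x ^ n = x ^ n / (‖x‖ : ℂ) ^ (2 * n) := by
    rw [pow_mul, hnorm, mul_pow]
    field_simp
  rw [eigenfunction, re_smul_add_im_smul_velocity_angular hn P.continuous_mode
    (hasCompactSupport_angular fun _ => P.mode_outer) hx0, P.integral_mode_inner hx,
    P.integral_mode_outer hx, hpow]
  linear_combination Complex.I / 2 * x ^ n * P.flux_div_sub_flux_neg n hr

lemma opK_eigenfunction (hn : n ≠ 0) {x : ℂ} (hx0 : x ≠ 0) : opK (vortex P.Z) P.eigenfunction x =
    n * Complex.I * (P.Z ‖x‖ - P.c) * P.eigenfunction x := by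
  have h : opK (vortex P.Z) P.eigenfunction x = -(deriv (vorticity P.Z) ‖x‖ / ‖x‖ : ℝ) *
      (x.re • (velocity P.eigenfunction x).1 + x.im • (velocity P.eigenfunction x).2) := by
    simp only [opK, partialX, partialY, fderiv_vortex P.contDiff_Z hx0, Complex.real_smul,
      Complex.one_re, Complex.one_im, Complex.I_re, Complex.I_im]
    push_cast
    ring
  rw [h]
  by_cases hx : ‖x‖ ∈ Icc 1 P.R
  · have hr : (‖x‖ : ℂ) ≠ 0 := by simpa using hx0
    rw [P.re_smul_add_im_smul_velocity_eigenfunction hn hx, eigenfunction, angular,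
      P.mode_of_one_le hx.1, stream]
    push_cast
    field_simp
  · have hW : deriv (vorticity P.Z) ‖x‖ = 0 := by
      rcases le_total ‖x‖ 1 with h1 | h1
      · exact P.deriv_vorticity_inner h1
      · exact P.deriv_vorticity_outer (not_lt.1 fun h2 => hx ⟨h1, h2.le⟩)
    simp [eigenfunction, angular, mode, hW]

lemma continuous_eigenfunction : Continuous P.eigenfunction :=
  continuous_angular P.continuous_mode

lemma hasCompactSupport_eigenfunction : HasCompactSupport P.eigenfunction :=
  hasCompactSupport_angular fun _ => P.mode_outer

lemma memLp_continuous_mul_eigenfunction {ζ : ℂ → ℂ} (hζ : Continuous ζ) :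
    MemLp (fun x => ζ x * P.eigenfunction x) 2 :=
  (hζ.mul P.continuous_eigenfunction).memLp_of_hasCompactSupport
    P.hasCompactSupport_eigenfunction.mul_left

lemma memLp_eigenfunction : MemLp P.eigenfunction 2 :=
  P.continuous_eigenfunction.memLp_of_hasCompactSupport P.hasCompactSupport_eigenfunction

lemma memU_eigenfunction : MemU n P.eigenfunction := by
  refine ⟨P.memLp_eigenfunction, fun r => r ^ n * P.mode r, Eventually.of_forall fun x => ?_⟩
  have hpolar : x ^ n = ‖x‖ ^ n * Complex.exp (Complex.I * n * x.arg) := by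
    conv_lhs => rw [← Complex.norm_mul_exp_arg_mul_I x]
    rw [mul_pow, ← Complex.exp_nat_mul]
    ring_nf
  rw [eigenfunction, angular, hpolar]
  ring

lemma not_ae_eigenfunction_eq_zero (hn : n ≠ 0) : ¬ ∀ᵐ x : ℂ, P.eigenfunction x = 0 := by
  intro h
  have hvel : velocity P.eigenfunction 1 = 0 := by
    refine Prod.ext ?_ ?_
    all_goals
      exact integral_eq_zero_of_ae (h.mono fun x hx => by simp only [hx, smul_zero, Pi.zero_apply])
  have hrad := P.re_smul_add_im_smul_velocity_eigenfunction hn (x := 1)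
    (by simpa using P.one_lt_R.le)
  have hZ0 := P.Z_sub_c_ne_zero 1
  simp [hvel, stream, P.F_one, hn, hZ0] at hrad

lemma isLinearizedEuler_eigenfunction (hn : n ≠ 0) : IsLinearizedEuler (vortex P.Z) P.eigenfunction
    fun x => -(n * Complex.I * P.c) * P.eigenfunction x := by
  have hZ := P.contDiff_Z.continuous
  have hK : ∀ᵐ x : ℂ, opK (vortex P.Z) P.eigenfunction x =
      n * Complex.I * (P.Z ‖x‖ - P.c) * P.eigenfunction x :=
    (Measure.ae_ne volume 0).mono fun x => P.opK_eigenfunction hn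
  refine ⟨P.memLp_eigenfunction,
    hasVelocity_of_continuous P.continuous_eigenfunction P.hasCompactSupport_eigenfunction,
    fun x => -(n * Complex.I) * P.Z ‖x‖ * P.eigenfunction x,
    P.memLp_continuous_mul_eigenfunction (by fun_prop),
    isTransport_angular (hasAngularVelocity_vortex P.contDiff_Z
      (hasCompactSupport_vortex P.differentiable_Z P.Z_outer)) hZ P.continuous_mode,
    (memLp_congr_ae hK).2 (P.memLp_continuous_mul_eigenfunction (by fun_prop)),
    hK.mono fun x hx => ?_⟩
  rw [hx]
  ring

end UnstableProfile

end Euler2D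

end

theorem mainTheorem2_general {n : ℕ} (hn : 2 ≤ n) :
    ∃ Ω : ℂ → ℝ, ContDiff ℝ ∞ Ω ∧ HasCompactSupport Ω ∧ Euler2D.IsVortex Ω ∧
      (∫ x : ℂ, Ω x) = 0 ∧
      ∃ (μ : ℂ) (w : ℂ → ℂ), 0 < μ.re ∧ Euler2D.MemU n w ∧ ¬ (∀ᵐ x : ℂ, w x = 0) ∧
        Euler2D.IsLinearizedEuler Ω w (fun x => μ * w x) := by
  have hn0 : n ≠ 0 := by omega
  have hν : 1 < (n : ℝ) := by exact_mod_cast hn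
  obtain ⟨P⟩ := Euler2D.nonempty_unstableProfile hν
  have hμ : 0 < (-(n * Complex.I * P.c)).re := by
    have := mul_pos (Nat.cast_pos.2 (Nat.pos_of_ne_zero hn0) : (0 : ℝ) < n) P.c_im_pos
    simpa using this
  have hcore : ∀ᶠ r in nhds 0, P.Z r = 1 :=
    (eventually_le_nhds one_pos).mono fun r => P.Z_inner r
  exact ⟨Euler2D.vortex P.Z, Euler2D.contDiff_vortex P.contDiff_Z hcore,
    Euler2D.hasCompactSupport_vortex P.differentiable_Z P.Z_outer, ⟨_, fun _ => rfl⟩,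
    Euler2D.integral_vortex P.contDiff_Z (by linarith [P.one_lt_R]) P.Z_outer,
    -(n * Complex.I * P.c), P.eigenfunction, hμ, P.memU_eigenfunction,
    P.not_ae_eigenfunction_eq_zero hn0, P.isLinearizedEuler_eigenfunction hn0⟩

theorem mainTheorem2 :
    ∃ Ω : ℂ → ℝ, ContDiff ℝ ∞ Ω ∧ HasCompactSupport Ω ∧ Euler2D.IsVortex Ω ∧
      (∫ x : ℂ, Ω x) = 0 ∧ Euler2D.IsUnstable Ω := by
  obtain ⟨Ω, hsmooth, hsupp, hvortex, hmean, hunstable⟩ := mainTheorem2_general le_rfl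
  exact ⟨Ω, hsmooth, hsupp, hvortex, hmean, 2, one_le_two, hunstable⟩
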